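/- Let $(V,Y,\mathbf 1,\omega)$ be a vertex operator algebra over $\mathbb C$ ($V=\bigoplus_{n\in\mathbb Z}V_n$ with $\dim V_n<\infty$ and $V_n=0$ for $n\ll 0$), write $\mathrm{wt}(a)=n$ for $a\in V_n$, and let $(M,Y_M)$ be a $V$-module, that is, a weak $V$-module which is the direct sum of the eigenspaces $M(\lambda)$, $\lambda\in\mathbb C$, of $L(0)$, where $\dim M(\lambda)<\infty$ and, for each fixed $\lambda$, $M(\lambda+n)=0$ for all sufficiently small integers $n$. For homogeneous $a\in V$ and $u\in M$ put $$a*u=\mathrm{Res}_z\frac{(1+z)^{\mathrm{wt}(a)}}{z}Y_M(a,z)u,\qquad u*a=\mathrm{Res}_z\frac{(1+z)^{\mathrm{wt}(a)-1}}{z}Y_M(a,z)u,\qquad a\circ u=\mathrm{Res}_z\frac{(1+z)^{\mathrm{wt}(a)}}{z^{2}}Y_M(a,z)u,$$ with $(1+z)^k$ expanded in nonnegative powers of $z$, and extend these linearly to all $a\in V$. Let $O(M)$ be the linear span of all $a\circ u$ and $A(M)=M/O(M)$, with $[u]$ the class of $u$; the actions of $A(V)$ on $A(M)$ are given by $[a]*[u]=[a*u]$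 and $[u]*[a]=[u*a]$. For $M=V$ (with $Y_M=Y$) the product $[a]*[b]=[a*b]$, $a*b=\mathrm{Res}_z\frac{(1+z)^{\mathrm{wt}(a)}}{z}Y(a,z)b$, is that of Zhu's algebra $A(V)$. Let $\phi_M=e^{L(1)}e^{\pi i L(0)}:M\to M$, where $e^{\pi i L(0)}$ acts on $M(\lambda)$ as $e^{\pi i\lambda}$, and let $\phi_V$ be this map for the module $V$. Then for all $a\in V$ and $u\in M$ $$\phi_M(a*u)=\phi_M(u)*\phi_V(a),\qquad \phi_M(u*a)=\phi_V(a)*\phi_M(u),\qquad \phi_M(a\circ u)=-\phi_V(a)\circ\phi_M(u).$$ Consequently $\phi_M$ induces a bijective linear map $\Phi_M$ of $A(M)$, $\Phi_M([u])=[\phi_M(u)]$, with $$\Phi_M([a*u])=[\phi_M(u)*\phi_V(a)],\qquad \Phi_M([u*a])=[\phi_V(a)*\phi_M(u)]\qquad(a\in V,\ u\in M);$$ and $\phi_V$ induces an anti-automorphism of $A(V)$: the map $\Phi_V([a])=[\phi_V(a)]$ is a well-defined linear bijection of $A(V)$ with $\Phi_V([a*b])=[\phi_V(b)*\phi_V(a)]$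 for all $a,b\in V$, where $*$ is Zhu's product. -/

import Mathlib

noncomputable section

/-- The mode `a_n` of `Y(a,z) = ∑ a_n z^(-n-1)`, for a linear map `a ↦ Y(a,z)` that sends `V` to
vertex operators on `M`. -/
abbrev vertexMode {V M : Type*} [AddCommGroup V] [Module ℂ V] [AddCommGroup M] [Module ℂ M]
    (Y : V →ₗ[ℂ] VertexOperator ℂ M) (a : V) (n : ℤ) : Module.End ℂ M :=
  VertexOperator.ncoeff (Y a) n

/-- The Jacobi identity for a vertex operator map `Y` on `V` and a map `YM` giving the action of `V`
on `M`. It is the equality of the coefficients of `z₀^(-l-1) z₁^(-m-1) z₂^(-n-1)` on the two sides of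
`z₀⁻¹ δ((z₁-z₂)/z₀) YM(a,z₁) YM(b,z₂) - z₀⁻¹ δ((z₂-z₁)/(-z₀)) YM(b,z₂) YM(a,z₁)`
`= z₂⁻¹ δ((z₁-z₀)/z₂) YM(Y(a,z₀)b,z₂)`, applied to `u`.
All sums are finite, since a `VertexOperator` takes values in Laurent series. -/
def JacobiIdentity {V M : Type*} [AddCommGroup V] [Module ℂ V] [AddCommGroup M] [Module ℂ M]
    (Y : V →ₗ[ℂ] VertexOperator ℂ V) (YM : V →ₗ[ℂ] VertexOperator ℂ M) : Prop :=
  ∀ (a b : V) (u : M) (l m n : ℤ),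
    (∑ᶠ i : ℕ, ((-1 : ℂ) ^ i * (Ring.choose l i : ℤ)) •
        (vertexMode YM a (l + m - i) (vertexMode YM b (n + i) u)
          - (-1 : ℂ) ^ l • vertexMode YM b (l + n - i) (vertexMode YM a (m + i) u)))
      = ∑ᶠ i : ℕ, ((Ring.choose m i : ℤ) : ℂ) •
          vertexMode YM (vertexMode Y a (l + i) b) (m + n - i) u

/-- A vertex operator algebra structure on the complex vector space `V`. The truncation condition
`Y(a,z)b ∈ V((z))` is part of the type of `Y`. -/
structure VertexOperatorAlgebra (V : Type*) [AddCommGroup V] [Module ℂ V] where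
  /-- the linear map `a ↦ Y(a,z) = ∑ a_n z^(-n-1)` -/
  Y : V →ₗ[ℂ] VertexOperator ℂ V
  /-- the vacuum vector -/
  vac : V
  /-- the Virasoro vector `ω` -/
  omega : V
  /-- the central charge -/
  c : ℂ
  /-- the homogeneous subspace `V_n` of weight `n` -/
  gr : ℤ → Submodule ℂ V
  isInternal : DirectSum.IsInternal gr
  finiteDimensional : ∀ n, FiniteDimensional ℂ (gr n)
  gr_eq_bot : ∃ N : ℤ, ∀ n < N, gr n = ⊥
  vac_mem : vac ∈ gr 0
  omega_mem : omega ∈ gr 2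
  jacobi : JacobiIdentity Y Y
  Y_vac : ∀ (n : ℤ) (a : V), vertexMode Y vac n a = if n = -1 then a else 0
  Y_apply_vac : ∀ (a : V) (n : ℤ), 0 ≤ n → vertexMode Y a n vac = 0
  Y_neg_one_vac : ∀ a : V, vertexMode Y a (-1) vac = a
  /-- the operators `L(n) = ω_{n+1}` satisfy the Virasoro relations of central charge `c` -/
  virasoro : ∀ (m n : ℤ) (a : V),
    vertexMode Y omega (m + 1) (vertexMode Y omega (n + 1) a)
        - vertexMode Y omega (n + 1) (vertexMode Y omega (m + 1) a)
      = ((m : ℂ) - n) • vertexMode Y omega (m + n + 1) a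
        + (if m + n = 0 then ((m : ℂ) ^ 3 - m) / 12 * c else 0) • a
  /-- `L(0) a = n a` for `a ∈ V_n` -/
  L_zero : ∀ (n : ℤ), ∀ a ∈ gr n, vertexMode Y omega 1 a = (n : ℂ) • a
  /-- `Y(L(-1) a, z) = d/dz Y(a, z)` -/
  L_neg_one : ∀ (a : V) (n : ℤ),
    vertexMode Y (vertexMode Y omega 0 a) n = (-n : ℂ) • vertexMode Y a (n - 1)

/-- The exponential `∑ T^k / k!` of a locally nilpotent operator. -/
def locallyNilpotentExp {M : Type*} [AddCommGroup M] [Module ℂ M] (T : Module.End ℂ M)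
    (hT : ∀ u, ∃ k : ℕ, (T ^ k) u = 0) : Module.End ℂ M :=
  have fin : ∀ u, (Function.support fun k : ℕ => ((k.factorial : ℂ)⁻¹) • (T ^ k) u).Finite := by
    intro u
    obtain ⟨K, hK⟩ := hT u
    refine (Set.finite_lt_nat K).subset fun k hk => ?_
    by_contra h
    refine hk ?_
    obtain ⟨j, rfl⟩ : ∃ j, k = j + K := ⟨k - K, by grind⟩
    simp [pow_add, hK]
  { toFun := fun u => ∑ᶠ k : ℕ, ((k.factorial : ℂ)⁻¹) • (T ^ k) u
    map_add' := fun u v => by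
      rw [← finsum_add_distrib (fin u) (fin v)]
      simp
    map_smul' := fun r u => by
      rw [RingHom.id_apply, smul_finsum]
      simp [smul_comm r] }

/-- For `T` acting semisimply on `M`, the operator `e^{s T}` that acts on the eigenspace of `T`
for the eigenvalue `t` as the scalar `e^{s t}`. -/
def semisimpleExp {M : Type*} [AddCommGroup M] [Module ℂ M] (s : ℂ) (T : Module.End ℂ M)
    (hT : DirectSum.IsInternal (fun t : ℂ => T.eigenspace t)) : Module.End ℂ M :=
  DirectSum.toModule ℂ ℂ M (fun t : ℂ => Complex.exp (s * t) • (T.eigenspace t).subtype)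
    ∘ₗ (LinearEquiv.ofBijective (DirectSum.coeLinearMap fun t : ℂ => T.eigenspace t) hT).symm

theorem semisimpleExp_apply {M : Type*} [AddCommGroup M] [Module ℂ M] (s : ℂ) (T : Module.End ℂ M)
    (hT : DirectSum.IsInternal (fun t : ℂ => T.eigenspace t)) (t : ℂ) (u : M) (hu : T u = t • u) :
    semisimpleExp s T hT u = Complex.exp (s * t) • u := by
  have h : (LinearEquiv.ofBijective (DirectSum.coeLinearMap fun t : ℂ => T.eigenspace t) hT).symm u
      = DirectSum.lof ℂ ℂ (fun t : ℂ => T.eigenspace t) t ⟨u, Module.End.mem_eigenspace_iff.2 hu⟩ := by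
    rw [LinearEquiv.symm_apply_eq]
    exact (DirectSum.coeLinearMap_lof (fun t : ℂ => T.eigenspace t) t
      ⟨u, Module.End.mem_eigenspace_iff.2 hu⟩).symm
  simp [semisimpleExp, h]

namespace VertexOperatorAlgebra

/-- A weak `V`-module structure on the complex vector space `M`. The truncation condition
`Y_M(a,z)u ∈ M((z))` is part of the type of `Y`. -/
structure WeakModule {V : Type*} [AddCommGroup V] [Module ℂ V] (𝒱 : VertexOperatorAlgebra V)
    (M : Type*) [AddCommGroup M] [Module ℂ M] where
  /-- the linear map `a ↦ Y_M(a,z) = ∑ a_n z^(-n-1)` -/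
  Y : V →ₗ[ℂ] VertexOperator ℂ M
  Y_vac : ∀ (n : ℤ) (u : M), vertexMode Y 𝒱.vac n u = if n = -1 then u else 0
  jacobi : JacobiIdentity 𝒱.Y Y

/-- The operator `L(n) = ω_{n+1}` on a weak module. -/
def WeakModule.L {V : Type*} [AddCommGroup V] [Module ℂ V] {𝒱 : VertexOperatorAlgebra V}
    {M : Type*} [AddCommGroup M] [Module ℂ M] (W : 𝒱.WeakModule M) (n : ℤ) : Module.End ℂ M :=
  vertexMode W.Y 𝒱.omega (n + 1)

/-- An (ordinary) `V`-module: a weak module that is the direct sum of the eigenspaces of `L(0)`,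
with finite-dimensional eigenspaces and such that for each `t : ℂ` the eigenspace for `t + n`
vanishes for all sufficiently small integers `n`. -/
structure OrdinaryModule {V : Type*} [AddCommGroup V] [Module ℂ V] (𝒱 : VertexOperatorAlgebra V)
    (M : Type*) [AddCommGroup M] [Module ℂ M] extends 𝒱.WeakModule M where
  isInternal : DirectSum.IsInternal (fun t : ℂ => (toWeakModule.L 0).eigenspace t)
  finiteDimensional : ∀ t : ℂ, FiniteDimensional ℂ ((toWeakModule.L 0).eigenspace t)
  eigenspace_eq_bot : ∀ t : ℂ, ∃ N : ℤ, ∀ n < N, (toWeakModule.L 0).eigenspace (t + n) = ⊥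

section

variable {V : Type*} [AddCommGroup V] [Module ℂ V] {𝒱 : VertexOperatorAlgebra V}
  {M : Type*} [AddCommGroup M] [Module ℂ M]

/-! ### The algebra as a module over itself -/

theorem iSup_gr (𝒱 : VertexOperatorAlgebra V) : ⨆ n, 𝒱.gr n = ⊤ :=
  (DirectSum.isInternal_submodule_iff_iSupIndep_and_iSup_eq_top _).1 𝒱.isInternal |>.2

theorem exists_of_mem_eigenspace (𝒱 : VertexOperatorAlgebra V) (t : ℂ) (x : V)
    (hx : vertexMode 𝒱.Y 𝒱.omega 1 x = t • x) (h0 : x ≠ 0) : ∃ n : ℤ, t = n ∧ x ∈ 𝒱.gr n := by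
  classical
  obtain ⟨y, rfl⟩ := 𝒱.isInternal.surjective x
  have key : ∀ y : DirectSum ℤ fun n => 𝒱.gr n,
      vertexMode 𝒱.Y 𝒱.omega 1 (DirectSum.coeAddMonoidHom 𝒱.gr y)
        - t • DirectSum.coeAddMonoidHom 𝒱.gr y
      = DirectSum.coeAddMonoidHom 𝒱.gr
          (DFinsupp.mapRange.linearMap (fun n : ℤ => ((n : ℂ) - t) • LinearMap.id
            (R := ℂ) (M := 𝒱.gr n)) y) := by
    intro y
    induction y using DirectSum.induction_on with
    | zero => simp
    | of n z =>
      have := DFinsupp.mapRange_single (f := fun n : ℤ => ⇑(((n : ℂ) - t) • LinearMap.id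
            (R := ℂ) (M := 𝒱.gr n))) (hf := by simp) (i := n) (b := z)
      simp only [DFinsupp.mapRange.linearMap_apply]
      erw [this]
      rw [DirectSum.coeAddMonoidHom_of, 𝒱.L_zero n z z.2]
      erw [DirectSum.coeAddMonoidHom_of]
      simp [sub_smul]
    | add y z hy hz =>
      simp only [map_add, smul_add, ← hy, ← hz]
      abel
  have h1 := key y
  rw [hx, sub_self] at h1
  have h2 := 𝒱.isInternal.injective (h1.symm.trans (map_zero _).symm)
  have h3 : ∀ n : ℤ, (n : ℂ) ≠ t → y n = 0 := by
    intro n hn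
    have h4 := DFunLike.congr_fun h2 n
    simp only [DFinsupp.mapRange.linearMap_apply] at h4
    have h5 : ((n : ℂ) - t) • y n = 0 := h4
    exact (smul_eq_zero.1 h5).resolve_left (sub_ne_zero.2 hn)
  obtain ⟨n, hn⟩ : ∃ n, y n ≠ 0 := by
    by_contra! h
    exact h0 (by rw [show y = 0 from DFinsupp.ext h, map_zero])
  have hnt : (n : ℂ) = t := by
    by_contra h
    exact hn (h3 n h)
  refine ⟨n, hnt.symm, ?_⟩
  have : y = DirectSum.of (fun n => 𝒱.gr n) n (y n) := by
    refine DFinsupp.ext fun k => ?_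
    by_cases hk : k = n
    · subst hk
      exact (DirectSum.of_eq_same (β := fun n => 𝒱.gr n) k (y k)).symm
    · refine (h3 k fun h => hk ?_).trans (DirectSum.of_eq_of_ne (β := fun n => 𝒱.gr n) n k (y n) hk).symm
      exact_mod_cast h.trans hnt.symm
  rw [this, DirectSum.coeAddMonoidHom_of]
  exact (y n).2

/-- `V` as a module over itself. -/
def adjointModule (𝒱 : VertexOperatorAlgebra V) : 𝒱.OrdinaryModule V where
  Y := 𝒱.Y
  Y_vac := 𝒱.Y_vac
  jacobi := 𝒱.jacobi
  isInternal := by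
    rw [DirectSum.isInternal_submodule_iff_iSupIndep_and_iSup_eq_top]
    refine ⟨Module.End.eigenspaces_iSupIndep _, top_le_iff.1 ?_⟩
    rw [← 𝒱.iSup_gr]
    exact iSup_le fun n => le_iSup_of_le (n : ℂ) fun a ha =>
      Module.End.mem_eigenspace_iff.2 (𝒱.L_zero n a ha)
  finiteDimensional := fun t => by
    by_cases h : ∃ n : ℤ, t = n
    · obtain ⟨n, rfl⟩ := h
      have := 𝒱.finiteDimensional n
      refine Submodule.finiteDimensional_of_le (S₂ := 𝒱.gr n) fun x hx => ?_
      by_cases h0 : x = 0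
      · simp [h0]
      · obtain ⟨k, hk, hx'⟩ :=
          𝒱.exists_of_mem_eigenspace n x (Module.End.mem_eigenspace_iff.1 hx) h0
        rwa [Int.cast_inj.1 hk]
    · refine Submodule.finiteDimensional_of_le (S₂ := ⊥) fun x hx => ?_
      by_contra h0
      obtain ⟨k, hk, -⟩ := 𝒱.exists_of_mem_eigenspace t x (Module.End.mem_eigenspace_iff.1 hx) h0
      exact h ⟨k, hk⟩
  eigenspace_eq_bot := fun t => by
    obtain ⟨N, hN⟩ := 𝒱.gr_eq_bot
    by_cases h : ∃ n : ℤ, t = n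
    · obtain ⟨n, rfl⟩ := h
      refine ⟨N - n, fun k hk => (Submodule.eq_bot_iff _).2 fun x hx => ?_⟩
      by_contra h0
      obtain ⟨j, hj, hx'⟩ := 𝒱.exists_of_mem_eigenspace _ x (Module.End.mem_eigenspace_iff.1 hx) h0
      have hj' : n + k = j := by exact_mod_cast hj
      rw [hN j (by lia)] at hx'
      exact h0 hx'
    · refine ⟨0, fun k _ => (Submodule.eq_bot_iff _).2 fun x hx => ?_⟩
      by_contra h0
      obtain ⟨j, hj, -⟩ := 𝒱.exists_of_mem_eigenspace _ x (Module.End.mem_eigenspace_iff.1 hx) h0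
      exact h ⟨j - k, by push_cast; rw [← hj]; ring⟩

/-! ### `L(1)` is locally nilpotent on a module -/

theorem WeakModule.mode_omega_comm (W : 𝒱.WeakModule M) (u : M) :
    W.L 0 (W.L 1 u) - W.L 1 (W.L 0 u) = - W.L 1 u := by
  have hω0 : vertexMode 𝒱.Y 𝒱.omega 0 𝒱.omega = vertexMode 𝒱.Y 𝒱.omega (-2) 𝒱.vac := by
    have h := LinearMap.congr_fun (𝒱.L_neg_one 𝒱.omega (-1)) 𝒱.vac
    rw [𝒱.Y_neg_one_vac] at h
    simpa using h
  have hω1 : vertexMode 𝒱.Y 𝒱.omega 1 𝒱.omega = (2 : ℂ) • 𝒱.omega := by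
    simpa using 𝒱.L_zero 2 𝒱.omega 𝒱.omega_mem
  have hd : vertexMode W.Y (vertexMode 𝒱.Y 𝒱.omega (-2) 𝒱.vac) 3 u
      = (-3 : ℂ) • vertexMode W.Y 𝒱.omega 2 u := by
    have h := W.jacobi 𝒱.omega 𝒱.vac u (-2) 0 3
    rw [finsum_eq_single _ 2, finsum_eq_single _ 0] at h
    · have c2 : Ring.choose (-2 : ℤ) 2 = 3 := by
        simp [Ring.choose_neg]; decide
      simp [W.Y_vac, c2] at h
      simpa using h.symm
    · intro i hi
      simp [Ring.choose_zero_pos ℤ (Nat.pos_of_ne_zero hi)]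
    · intro i hi
      have h1 : ¬ (3 + (i : ℤ) = -1) := by lia
      have h2 : ¬ (-2 + 3 - (i : ℤ) = -1) := by lia
      simp only [W.Y_vac, h1, h2, if_false]
      simp
  have h := W.jacobi 𝒱.omega 𝒱.omega u 0 1 2
  rw [finsum_eq_single _ 0, finsum_eq_sum_of_support_subset (s := Finset.range 2)] at h
  · simp [Finset.sum_range_succ, hω0, hω1] at h
    rw [hd] at h
    have h2 : vertexMode W.Y ((2 : ℂ) • 𝒱.omega) 2 u = (2 : ℂ) • vertexMode W.Y 𝒱.omega 2 u := by
      simp [vertexMode]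
    rw [h2] at h
    refine Eq.trans ?_ (h.trans ?_)
    · rfl
    · change _ = - vertexMode W.Y 𝒱.omega 2 u
      module
  · intro i hi
    by_contra hi'
    simp only [Finset.coe_range, Set.mem_Iio, not_lt] at hi'
    refine hi ?_
    have hc : Ring.choose (1 : ℤ) i = 0 := by
      have := Ring.choose_natCast (R := ℤ) 1 i
      rw [Nat.choose_eq_zero_of_lt (by lia)] at this
      simpa using this
    simp [hc]
  · intro i hi
    simp [Ring.choose_zero_pos ℤ (Nat.pos_of_ne_zero hi)]

theorem OrdinaryModule.L_one_locally_nilpotent (W : 𝒱.OrdinaryModule M) (u : M) :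
    ∃ k : ℕ, (W.L 1 ^ k) u = 0 := by
  have step : ∀ (t : ℂ) (k : ℕ), ∀ x ∈ (W.L 0).eigenspace t,
      (W.L 1 ^ k) x ∈ (W.L 0).eigenspace (t + ((-k : ℤ) : ℂ)) := by
    intro t k x hx
    induction k with
    | zero => simpa using hx
    | succ k ih =>
      rw [Module.End.mem_eigenspace_iff] at ih ⊢
      have h := W.mode_omega_comm ((W.L 1 ^ k) x)
      rw [ih, map_smul] at h
      rw [pow_succ', Module.End.mul_apply, sub_eq_iff_eq_add.1 h]
      push_cast
      module
  have hu : u ∈ ⨆ t : ℂ, (W.L 0).eigenspace t := by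
    rw [((DirectSum.isInternal_submodule_iff_iSupIndep_and_iSup_eq_top _).1 W.isInternal).2]
    trivial
  induction hu using Submodule.iSup_induction' with
  | zero => exact ⟨0, by simp⟩
  | mem t x hx =>
    obtain ⟨N, hN⟩ := W.eigenspace_eq_bot t
    refine ⟨(1 - N).toNat, ?_⟩
    have h := step t (1 - N).toNat x hx
    rw [hN _ (by lia)] at h
    simpa using h
  | add x y _ _ hx hy =>
    obtain ⟨k, hk⟩ := hx
    obtain ⟨l, hl⟩ := hy
    refine ⟨k + l, ?_⟩
    rw [map_add]
    nth_rewrite 1 [add_comm k l]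
    simp [pow_add, hk, hl]

end

/-- The linear map `φ_M = e^{L(1)} e^{π i L(0)}`. -/
def OrdinaryModule.phi {V : Type*} [AddCommGroup V] [Module ℂ V] {𝒱 : VertexOperatorAlgebra V}
    {M : Type*} [AddCommGroup M] [Module ℂ M] (W : 𝒱.OrdinaryModule M) : M →ₗ[ℂ] M :=
  locallyNilpotentExp (W.L 1) W.L_one_locally_nilpotent
    ∘ₗ semisimpleExp (Real.pi * Complex.I) (W.L 0) W.isInternal

/-- `Res_z (1+z)^p z^(-q) Y_M(a,z) u = ∑ i, (p choose i) a_{i-q} u`, with `(1+z)^p` expanded in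
nonnegative powers of `z`. -/
def WeakModule.res {V : Type*} [AddCommGroup V] [Module ℂ V] {𝒱 : VertexOperatorAlgebra V}
    {M : Type*} [AddCommGroup M] [Module ℂ M] (W : 𝒱.WeakModule M) (p q : ℤ) :
    V →ₗ[ℂ] M →ₗ[ℂ] M :=
  have fin : ∀ a u, (Function.support fun i : ℕ =>
      ((Ring.choose p i : ℤ) : ℂ) • vertexMode W.Y a (i - q) u).Finite := by
    intro a u
    refine (Set.finite_lt_nat (q - ((HahnModule.of ℂ).symm (W.Y a u)).order).toNat).subset
      fun i hi => ?_
    by_contra h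
    refine hi ?_
    have h' : (q - ((HahnModule.of ℂ).symm (W.Y a u)).order).toNat ≤ i := not_lt.1 h
    have h0 : vertexMode W.Y a (i - q) u = 0 :=
      VertexOperator.ncoeff_eq_zero_of_lt_order _ _ _ (by lia)
    simp [h0]
  LinearMap.mk₂ ℂ
    (fun a u => ∑ᶠ i : ℕ, ((Ring.choose p i : ℤ) : ℂ) • vertexMode W.Y a (i - q) u)
    (fun a b u => by rw [← finsum_add_distrib (fin a u) (fin b u)]; simp [vertexMode])
    (fun r a u => by rw [smul_finsum]; simp [vertexMode, smul_comm r])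
    (fun a u v => by rw [← finsum_add_distrib (fin a u) (fin a v)]; simp)
    (fun r a u => by rw [smul_finsum]; simp [smul_comm r])

/-- The bilinear map given by `Res_z (1+z)^(wt a + s) z^(-q) Y_M(a,z) u` for homogeneous `a` and
extended to all `a` by linearity. -/
def WeakModule.zhuRes {V : Type*} [AddCommGroup V] [Module ℂ V] {𝒱 : VertexOperatorAlgebra V}
    {M : Type*} [AddCommGroup M] [Module ℂ M] (W : 𝒱.WeakModule M) (s q : ℤ) :
    V →ₗ[ℂ] M →ₗ[ℂ] M :=
  DirectSum.toModule ℂ ℤ (M →ₗ[ℂ] M) (fun n : ℤ => W.res (n + s) q ∘ₗ (𝒱.gr n).subtype)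
    ∘ₗ (LinearEquiv.ofBijective (DirectSum.coeLinearMap 𝒱.gr) 𝒱.isInternal).symm

theorem WeakModule.zhuRes_apply {V : Type*} [AddCommGroup V] [Module ℂ V]
    {𝒱 : VertexOperatorAlgebra V} {M : Type*} [AddCommGroup M] [Module ℂ M] (W : 𝒱.WeakModule M)
    (s q n : ℤ) (a : V) (ha : a ∈ 𝒱.gr n) (u : M) :
    W.zhuRes s q a u
      = ∑ᶠ i : ℕ, ((Ring.choose (n + s) i : ℤ) : ℂ) • vertexMode W.Y a (i - q) u := by
  have h : (LinearEquiv.ofBijective (DirectSum.coeLinearMap 𝒱.gr) 𝒱.isInternal).symm a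
      = DirectSum.lof ℂ ℤ (fun n => 𝒱.gr n) n ⟨a, ha⟩ := by
    rw [LinearEquiv.symm_apply_eq]
    exact (DirectSum.coeLinearMap_lof 𝒱.gr n ⟨a, ha⟩).symm
  simp [WeakModule.zhuRes, h, WeakModule.res]

/-- `a * u = Res_z (1+z)^(wt a) z⁻¹ Y_M(a,z) u`. -/
def WeakModule.lmul {V : Type*} [AddCommGroup V] [Module ℂ V] {𝒱 : VertexOperatorAlgebra V}
    {M : Type*} [AddCommGroup M] [Module ℂ M] (W : 𝒱.WeakModule M) (a : V) (u : M) : M :=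
  W.zhuRes 0 1 a u

/-- `u * a = Res_z (1+z)^(wt a - 1) z⁻¹ Y_M(a,z) u`. -/
def WeakModule.rmul {V : Type*} [AddCommGroup V] [Module ℂ V] {𝒱 : VertexOperatorAlgebra V}
    {M : Type*} [AddCommGroup M] [Module ℂ M] (W : 𝒱.WeakModule M) (u : M) (a : V) : M :=
  W.zhuRes (-1) 1 a u

/-- `a ∘ u = Res_z (1+z)^(wt a) z⁻² Y_M(a,z) u`. -/
def WeakModule.circ {V : Type*} [AddCommGroup V] [Module ℂ V] {𝒱 : VertexOperatorAlgebra V}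
    {M : Type*} [AddCommGroup M] [Module ℂ M] (W : 𝒱.WeakModule M) (a : V) (u : M) : M :=
  W.zhuRes 0 2 a u

/-- `O(M)`, the span of all `a ∘ u`. -/
def WeakModule.zhuO {V : Type*} [AddCommGroup V] [Module ℂ V] {𝒱 : VertexOperatorAlgebra V}
    {M : Type*} [AddCommGroup M] [Module ℂ M] (W : 𝒱.WeakModule M) : Submodule ℂ M :=
  Submodule.span ℂ {x | ∃ (a : V) (u : M), x = W.circ a u}

/-- `A(M) = M / O(M)`. -/
abbrev WeakModule.zhuA {V : Type*} [AddCommGroup V] [Module ℂ V] {𝒱 : VertexOperatorAlgebra V}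
    {M : Type*} [AddCommGroup M] [Module ℂ M] (W : 𝒱.WeakModule M) : Type _ :=
  M ⧸ W.zhuO

end VertexOperatorAlgebra

end

/-! ### Binomial coefficients -/

/-! Conjugation by `φ_M` is the substitution `w = -z/(1+z)`. The factor `e^{π i L(0)}` turns
`Y_M(a,z)` into `Y_M((-1)^{L(0)} a, -z)`, and conjugation by `e^{L(1)}` then gives `φ_M Y_M(a,z)
φ_M⁻¹ = Y_M(e^{(1+z)L(1)} (1+z)^{-2L(0)} (-1)^{L(0)} a, w)`. Here `1+z = (1+w)⁻¹`, `z = -w/(1+w)`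
and `dz = -(1+w)⁻² dw`. On the component `L(1)^j a / j!`, of weight `wt a - j`, the kernel
`(1+z)^{wt a + s} z^{-q} dz` therefore becomes `(-1)^{q+1} (1+w)^{(wt a - j) + (q-2-s)} w^{-q} dw`.
This is `OrdinaryModule.phi_zhuRes`: `φ_M` replaces `s` by `q-2-s` at the cost of the sign
`(-1)^{q+1}`. For `q = 1` it exchanges `s = 0` and `s = -1`, that is, left and right actions; for `q
= 2` it fixes `s = 0` with sign `-1`. All three identities are instances.

In modes, conjugation by `e^{L(1)}` is `OrdinaryModule.exp_L_one_mode`, obtained by iterating the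
commutator `WeakModule.L_one_mode`; the change of variables is the Vandermonde-type identity
`Int.sum_antidiagonal_neg_one_pow_mul_choose_mul_choose`.

Since `φ_M` and `φ_V` are bijective, `φ_M` maps `O(M)` onto itself and descends. For `A(V)`,
skew-symmetry together with `L(-1)a ≡ -wt(a) a` modulo `O(V)` identifies the right action with Zhu's
product (`mkQ_rmul_eq_mkQ_lmul`). -/

theorem Int.choose_neg_eq (r : ℤ) (n : ℕ) :
    Ring.choose (-r) n = (-1) ^ n * Ring.choose (r + n - 1) n := by
  rw [Ring.choose_neg, Int.negOnePow_def, Units.smul_def]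
  simp

theorem Int.succ_mul_choose_succ (x : ℤ) (r : ℕ) :
    ((r : ℤ) + 1) * Ring.choose x (r + 1) = Ring.choose x r * (x - r) := by
  have h := Ring.choose_smul_choose x (Nat.le_succ r)
  simpa [Ring.choose_one_right] using h

theorem Int.succ_mul_choose_succ' (x : ℤ) (r : ℕ) :
    ((r : ℤ) + 1) * Ring.choose x (r + 1) = x * Ring.choose (x - 1) r := by
  have h := Ring.choose_smul_choose x (n := r + 1) (k := 1) (by lia)
  simpa [Ring.choose_one_right] using h

/-- On the diagonal, upper negation turns the second factor into a sign times a coefficient with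
upper entry `k - y - 1`, independent of the summation index, so Vandermonde applies. This is the
coefficient form of the substitution `w = -z/(1+z)`. -/
theorem Int.sum_antidiagonal_neg_one_pow_mul_choose_mul_choose (p y : ℤ) (k : ℕ) :
    ∑ x ∈ Finset.HasAntidiagonal.antidiagonal k,
      (-1) ^ x.1 * Ring.choose p x.1 * Ring.choose (y - x.1) x.2 = Ring.choose (y - p) k := by
  have h := Ring.add_choose_eq k (Commute.all p (k - y - 1))
  have h' := Int.choose_neg_eq (p - y) k
  rw [neg_sub] at h'
  rw [h', show p - y + k - 1 = p + (k - y - 1) by ring, h, Finset.mul_sum]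
  refine Finset.sum_congr rfl fun x hx => ?_
  have hx' : (x.1 : ℤ) + x.2 = k := by exact_mod_cast Finset.HasAntidiagonal.mem_antidiagonal.1 hx
  have h2 := Int.choose_neg_eq (x.1 - y) x.2
  rw [neg_sub, show (x.1 : ℤ) - y + x.2 - 1 = k - y - 1 by rw [← hx']; ring] at h2
  rw [h2, ← Finset.HasAntidiagonal.mem_antidiagonal.1 hx, pow_add]
  ring

/-! ### Finite sums over the natural numbers -/

theorem finsum_eq_sum_range {A : Type*} [AddCommMonoid A] {f : ℕ → A} (N : ℕ)
    (h : ∀ i, N ≤ i → f i = 0) : ∑ᶠ i, f i = ∑ i ∈ Finset.range N, f i :=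
  finsum_eq_sum_of_support_subset f fun i hi => by
    by_contra hi'
    exact hi (h i (by simpa using hi'))

theorem finite_support_of_eventually_zero {A : Type*} [Zero A] {f : ℕ → A} (N : ℕ)
    (h : ∀ i, N ≤ i → f i = 0) : (Function.support f).Finite :=
  (Set.finite_lt_nat N).subset fun i hi => by
    by_contra hi'
    exact hi (h i (by simpa using hi'))

theorem finsum_finsum_eq_sum_sum {A : Type*} [AddCommMonoid A] {f : ℕ → ℕ → A} (N : ℕ)
    (h₁ : ∀ i j, N ≤ i → f i j = 0) (h₂ : ∀ i j, N ≤ j → f i j = 0) :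
    ∑ᶠ i, ∑ᶠ j, f i j = ∑ i ∈ Finset.range N, ∑ j ∈ Finset.range N, f i j := by
  rw [finsum_eq_sum_range N fun i hi => by simp [h₁ i _ hi]]
  exact Finset.sum_congr rfl fun i _ => finsum_eq_sum_range N (h₂ i)

theorem finsum_comm_of_eventually_zero {A : Type*} [AddCommMonoid A] {f : ℕ → ℕ → A} (N : ℕ)
    (h₁ : ∀ i j, N ≤ i → f i j = 0) (h₂ : ∀ i j, N ≤ j → f i j = 0) :
    ∑ᶠ i, ∑ᶠ j, f i j = ∑ᶠ j, ∑ᶠ i, f i j := by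
  rw [finsum_finsum_eq_sum_sum N h₁ h₂, Finset.sum_comm,
    finsum_finsum_eq_sum_sum (f := fun j i => f i j) N (fun j i => h₂ i j) (fun j i => h₁ i j)]

/-- The support lies in an `N × N` square, whose points all have coordinate sum below `2 * N`. -/
theorem finsum_sum_antidiagonal {A : Type*} [AddCommMonoid A] {f : ℕ → ℕ → A} (N : ℕ)
    (h₁ : ∀ i j, N ≤ i → f i j = 0) (h₂ : ∀ i j, N ≤ j → f i j = 0) :
    ∑ᶠ k, ∑ x ∈ Finset.HasAntidiagonal.antidiagonal k, f x.1 x.2 = ∑ᶠ i, ∑ᶠ j, f i j := by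
  rw [finsum_finsum_eq_sum_sum N h₁ h₂, ← Finset.sum_product',
    finsum_eq_sum_range (2 * N), ← Finset.sum_fiberwise_of_maps_to
      (s := Finset.range N ×ˢ Finset.range N) (t := Finset.range (2 * N)) (g := fun x => x.1 + x.2)]
  · refine Finset.sum_congr rfl fun k _ => (Finset.sum_subset ?_ ?_).symm
    · intro x hx
      simpa using (Finset.mem_filter.1 hx).2
    · intro x hx hx'
      have hx := Finset.HasAntidiagonal.mem_antidiagonal.1 hx
      by_cases h : N ≤ x.1
      · exact h₁ _ _ h
      · by_cases h' : N ≤ x.2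
        · exact h₂ _ _ h'
        · exact absurd (by simp; lia) hx'
  · intro x hx
    simp at hx ⊢
    lia
  · intro k hk
    refine Finset.sum_eq_zero fun x hx => ?_
    have hx := Finset.HasAntidiagonal.mem_antidiagonal.1 hx
    by_cases h : N ≤ x.1
    · exact h₁ _ _ h
    · exact h₂ _ _ (by lia)

/-! ### Exponentials -/

section exponential

variable {M : Type*} [AddCommGroup M] [Module ℂ M]

theorem locallyNilpotentExp_apply (T : Module.End ℂ M) (hT : ∀ u, ∃ k : ℕ, (T ^ k) u = 0) (u : M) :
    locallyNilpotentExp T hT u = ∑ᶠ k : ℕ, ((k.factorial : ℂ)⁻¹) • (T ^ k) u := rfl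

theorem Module.End.pow_apply_eq_zero_of_le {T : Module.End ℂ M} {u : M} {k l : ℕ}
    (h : (T ^ k) u = 0) (hkl : k ≤ l) : (T ^ l) u = 0 := by
  obtain ⟨j, rfl⟩ := Nat.exists_eq_add_of_le' hkl
  simp [pow_add, h]

theorem locallyNilpotentExp_apply_eq_sum (T : Module.End ℂ M) (hT : ∀ u, ∃ k : ℕ, (T ^ k) u = 0)
    {u : M} {K : ℕ} (hu : (T ^ K) u = 0) :
    locallyNilpotentExp T hT u = ∑ k ∈ Finset.range K, ((k.factorial : ℂ)⁻¹) • (T ^ k) u :=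
  finsum_eq_sum_range K fun k hk => by rw [Module.End.pow_apply_eq_zero_of_le hu hk, smul_zero]

/-- If `T^{k+1} u = 0`, then `T^k e^T u = T^k u`, so `e^T u = 0` lowers the nilpotency order of `u`
step by step. -/
theorem locallyNilpotentExp_injective (T : Module.End ℂ M) (hT : ∀ u, ∃ k : ℕ, (T ^ k) u = 0) :
    Function.Injective (locallyNilpotentExp T hT) := by
  refine (injective_iff_map_eq_zero _).2 fun u hu => ?_
  have key : ∀ k : ℕ, (T ^ k) u = 0 → u = 0 := by
    intro k
    induction k with
    | zero => intro h; simpa using h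
    | succ k ih =>
      intro h
      refine ih ?_
      have h1 := congrArg (T ^ k) hu
      rw [locallyNilpotentExp_apply_eq_sum T hT h, map_zero, map_sum, Finset.sum_range_succ',
        Finset.sum_eq_zero] at h1
      · simpa using h1
      · intro i _
        rw [map_smul, ← Module.End.mul_apply, ← pow_add,
          Module.End.pow_apply_eq_zero_of_le h (by lia), smul_zero]
  obtain ⟨k, hk⟩ := hT u
  exact key k hk

/-- The error `e^T u - u` is killed by a smaller power of `T` than `u`, so it lies in the range by
induction. -/
theorem locallyNilpotentExp_surjective (T : Module.End ℂ M) (hT : ∀ u, ∃ k : ℕ, (T ^ k) u = 0) :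
    Function.Surjective (locallyNilpotentExp T hT) := by
  have key : ∀ (k : ℕ) (u : M), (T ^ k) u = 0 → u ∈ LinearMap.range (locallyNilpotentExp T hT) := by
    intro k
    induction k with
    | zero =>
      intro u h
      have : u = 0 := by simpa using h
      simp [this]
    | succ k ih =>
      intro u h
      have h1 : (T ^ k) (locallyNilpotentExp T hT u - u) = 0 := by
        rw [locallyNilpotentExp_apply_eq_sum T hT h, Finset.sum_range_succ']
        simp only [Nat.factorial_zero, Nat.cast_one, inv_one, pow_zero, Module.End.one_apply,
          one_smul, add_sub_cancel_right, map_sum]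
        refine Finset.sum_eq_zero fun i _ => ?_
        rw [map_smul, ← Module.End.mul_apply, ← pow_add,
          Module.End.pow_apply_eq_zero_of_le h (by lia), smul_zero]
      have h2 := Submodule.sub_mem _ (LinearMap.mem_range_self (locallyNilpotentExp T hT) u) (ih _ h1)
      simpa using h2
  intro u
  obtain ⟨k, hk⟩ := hT u
  exact key k u hk

theorem semisimpleExp_leftInverse (s : ℂ) (T : Module.End ℂ M)
    (hT : DirectSum.IsInternal (fun t : ℂ => T.eigenspace t)) :
    Function.LeftInverse (semisimpleExp (-s) T hT) (semisimpleExp s T hT) := by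
  intro u
  have hu : u ∈ ⨆ t : ℂ, T.eigenspace t := by
    rw [((DirectSum.isInternal_submodule_iff_iSupIndep_and_iSup_eq_top _).1 hT).2]
    trivial
  induction hu using Submodule.iSup_induction' with
  | zero => simp
  | mem t x hx =>
    have hx := Module.End.mem_eigenspace_iff.1 hx
    rw [semisimpleExp_apply s T hT t x hx, map_smul, semisimpleExp_apply (-s) T hT t x hx, smul_smul,
      ← Complex.exp_add]
    simp
  | add x y _ _ hx hy => rw [map_add, map_add, hx, hy]

theorem semisimpleExp_bijective (s : ℂ) (T : Module.End ℂ M)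
    (hT : DirectSum.IsInternal (fun t : ℂ => T.eigenspace t)) :
    Function.Bijective (semisimpleExp s T hT) := by
  refine ⟨(semisimpleExp_leftInverse s T hT).injective, ?_⟩
  have := (semisimpleExp_leftInverse (-s) T hT).surjective
  rwa [neg_neg] at this

end exponential

namespace VertexOperatorAlgebra

section modes

variable {V : Type*} [AddCommGroup V] [Module ℂ V] {𝒱 : VertexOperatorAlgebra V}
  {M : Type*} [AddCommGroup M] [Module ℂ M]

/-! ### Modes and weights -/

theorem _root_.vertexMode_smul (Y : V →ₗ[ℂ] VertexOperator ℂ M) (r : ℂ) (a : V) (n : ℤ) :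
    vertexMode Y (r • a) n = r • vertexMode Y a n := by
  simp [vertexMode]

theorem _root_.vertexMode_zero (Y : V →ₗ[ℂ] VertexOperator ℂ M) (n : ℤ) :
    vertexMode Y 0 n = 0 := by
  simp [vertexMode]

theorem _root_.exists_vertexMode_eq_zero (Y : V →ₗ[ℂ] VertexOperator ℂ M) (a : V) (u : M) :
    ∃ K : ℕ, ∀ n : ℤ, K ≤ n → vertexMode Y a n u = 0 :=
  ⟨(-((HahnModule.of ℂ).symm (Y a u)).order).toNat, fun n hn =>
    VertexOperator.ncoeff_eq_zero_of_lt_order _ _ _ (by lia)⟩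

/-- Used with `f j = L(1)^j a`: a truncation bound uniform in `j` lets the multiple sums be
reordered. -/
theorem _root_.exists_forall_vertexMode_eq_zero (Y : V →ₗ[ℂ] VertexOperator ℂ M) (f : ℕ → V)
    (J : ℕ) (hf : ∀ j, J ≤ j → f j = 0) (u : M) :
    ∃ K : ℕ, ∀ (j : ℕ) (n : ℤ), K ≤ n → vertexMode Y (f j) n u = 0 := by
  choose K hK using fun j => exists_vertexMode_eq_zero Y (f j) u
  refine ⟨(Finset.range J).sup K, fun j n hn => ?_⟩
  by_cases hj : j < J
  · have := Finset.le_sup (f := K) (Finset.mem_range.2 hj)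
    exact hK j n (by lia)
  · rw [hf j (by lia), vertexMode_zero, LinearMap.zero_apply]

/-- The commutator formula for nonnegative modes of the first vector. -/
theorem WeakModule.mode_comm (W : 𝒱.WeakModule M) (a b : V) (u : M) (m : ℕ) (n : ℤ) :
    vertexMode W.Y a m (vertexMode W.Y b n u) - vertexMode W.Y b n (vertexMode W.Y a m u)
      = ∑ i ∈ Finset.range (m + 1), (m.choose i : ℂ) •
          vertexMode W.Y (vertexMode 𝒱.Y a i b) (m + n - i) u := by
  have h := W.jacobi a b u 0 m n
  rw [finsum_eq_single _ 0, finsum_eq_sum_range (m + 1)] at h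
  · simpa [Ring.choose_natCast] using h
  · intro i hi
    rw [Ring.choose_natCast, Nat.choose_eq_zero_of_lt (by lia)]
    simp
  · intro i hi
    simp [Ring.choose_zero_pos ℤ (Nat.pos_of_ne_zero hi)]

theorem L_neg_one_eq (𝒱 : VertexOperatorAlgebra V) (a : V) :
    vertexMode 𝒱.Y 𝒱.omega 0 a = vertexMode 𝒱.Y a (-2) 𝒱.vac := by
  have h := LinearMap.congr_fun (𝒱.L_neg_one a (-1)) 𝒱.vac
  rw [𝒱.Y_neg_one_vac] at h
  simpa using h

/-- `Y_M(L(-1) a, z) = d/dz Y_M(a, z)` on a weak module. -/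
theorem WeakModule.mode_L_neg_one (W : 𝒱.WeakModule M) (a : V) (n : ℤ) (u : M) :
    vertexMode W.Y (vertexMode 𝒱.Y 𝒱.omega 0 a) n u = (-n : ℂ) • vertexMode W.Y a (n - 1) u := by
  have hc : ∀ i : ℕ, (-1 : ℂ) ^ i * (Ring.choose (-2 : ℤ) i : ℤ) = i + 1 := by
    intro i
    have h1 := Int.choose_neg_eq 2 i
    rw [show (2 : ℤ) + i - 1 = ((i + 1 : ℕ) : ℤ) by push_cast; ring, Ring.choose_natCast,
      Nat.choose_succ_self_right] at h1
    rw [h1]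
    push_cast
    rw [← mul_assoc, ← mul_pow]
    simp
  have h := W.jacobi a 𝒱.vac u (-2) 0 n
  rw [𝒱.L_neg_one_eq]
  have hr : ∑ᶠ i : ℕ, ((Ring.choose (0 : ℤ) i : ℤ) : ℂ) •
      vertexMode W.Y (vertexMode 𝒱.Y a (-2 + i) 𝒱.vac) (0 + n - i) u
      = vertexMode W.Y (vertexMode 𝒱.Y a (-2) 𝒱.vac) n u := by
    rw [finsum_eq_single _ 0]
    · simp
    · intro i hi
      simp [Ring.choose_zero_pos ℤ (Nat.pos_of_ne_zero hi)]
  rw [← hr, ← h]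
  simp only [hc, W.Y_vac]
  -- The vacuum mode is nonzero only at index `-1`. For `n < 0` this selects one term of the first
  -- family, for `n > 0` one term of the second, for `n = 0` none.
  rcases lt_trichotomy n 0 with hn | rfl | hn
  · obtain ⟨i, rfl⟩ : ∃ i : ℕ, n = -1 - i := ⟨(-1 - n).toNat, by lia⟩
    rw [finsum_eq_single _ i]
    · have h2 : ¬ (-2 + (-1 - (i : ℤ)) - i = -1) := by lia
      rw [if_neg h2, if_pos (by ring), show (-2 + 0 - (i : ℤ)) = -1 - i - 1 by ring]
      push_cast
      simp only [smul_zero, sub_zero]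
      congr 1
      ring
    · intro j hj
      have h1 : ¬ (-1 - (i : ℤ) + j = -1) := by lia
      have h2 : ¬ (-2 + (-1 - (i : ℤ)) - j = -1) := by lia
      simp [h1, h2]
  · rw [finsum_eq_zero_of_forall_eq_zero]
    · simp
    · intro j
      have h1 : ¬ ((0 : ℤ) + j = -1) := by lia
      have h2 : ¬ (-2 + (0 : ℤ) - j = -1) := by lia
      rw [if_neg h1, if_neg h2]
      simp
  · obtain ⟨i, rfl⟩ : ∃ i : ℕ, n = 1 + i := ⟨(n - 1).toNat, by lia⟩
    rw [finsum_eq_single _ i]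
    · have h1 : ¬ (1 + (i : ℤ) + i = -1) := by lia
      rw [if_neg h1, if_pos (by ring), show ((0 : ℤ) + i) = 1 + i - 1 by ring]
      push_cast
      simp only [map_zero, zero_sub, smul_smul, ← neg_smul]
      congr 1
      norm_num [zpow_neg]
      ring
    · intro j hj
      have h1 : ¬ (1 + (i : ℤ) + j = -1) := by lia
      have h2 : ¬ (-2 + (1 + (i : ℤ)) - j = -1) := by lia
      simp [h1, h2]

theorem WeakModule.L_zero_mode (W : 𝒱.WeakModule M) {n : ℤ} {a : V} (ha : a ∈ 𝒱.gr n) (k : ℤ)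
    (u : M) : W.L 0 (vertexMode W.Y a k u)
      = vertexMode W.Y a k (W.L 0 u) + ((n : ℂ) - k - 1) • vertexMode W.Y a k u := by
  have h := W.mode_comm 𝒱.omega a u 1 k
  have h0 := 𝒱.L_neg_one a
  have h1 := 𝒱.L_zero n a ha
  have h2 : ∀ j, vertexMode W.Y (vertexMode 𝒱.Y 𝒱.omega 0 a) j u
      = (-j : ℂ) • vertexMode W.Y a (j - 1) u := fun j => W.mode_L_neg_one a j u
  simp only [Finset.sum_range_succ, Finset.range_zero, Finset.sum_empty, Nat.choose_zero_right,
    Nat.choose_self, Nat.cast_zero, Nat.cast_one, h1, h2, vertexMode_smul, LinearMap.smul_apply] at h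
  rw [sub_eq_iff_eq_add] at h
  refine Eq.trans ?_ (h.trans ?_)
  · rfl
  · rw [show (1 : ℤ) + k - 0 - 1 = k by ring, show (1 : ℤ) + k - 1 = k by ring]
    change _ = vertexMode W.Y a k (vertexMode W.Y 𝒱.omega 1 u) + _
    push_cast
    module
-- The commutator formula for `ω_2` has three terms, from `L(-1)a`, `L(0)a` and `L(1)a`; the first
-- two combine to `(-(k+2) + 2n) a_{k+1}`.
theorem WeakModule.L_one_mode (W : 𝒱.WeakModule M) {n : ℤ} {a : V} (ha : a ∈ 𝒱.gr n) (k : ℤ)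
    (u : M) : W.L 1 (vertexMode W.Y a k u)
      = vertexMode W.Y a k (W.L 1 u) + ((2 * n - k - 2 : ℤ) : ℂ) • vertexMode W.Y a (k + 1) u
        + vertexMode W.Y (𝒱.adjointModule.L 1 a) k u := by
  have h := W.mode_comm 𝒱.omega a u 2 k
  have h1 := 𝒱.L_zero n a ha
  have h2 : ∀ j, vertexMode W.Y (vertexMode 𝒱.Y 𝒱.omega 0 a) j u
      = (-j : ℂ) • vertexMode W.Y a (j - 1) u := fun j => W.mode_L_neg_one a j u
  simp only [Finset.sum_range_succ, Finset.range_zero, Finset.sum_empty, Nat.choose_zero_right,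
    Nat.choose_self, Nat.cast_zero, Nat.cast_one, h1, h2, vertexMode_smul, LinearMap.smul_apply,
    Nat.choose_one_right, Nat.cast_ofNat] at h
  rw [sub_eq_iff_eq_add] at h
  refine Eq.trans ?_ (h.trans ?_)
  · rfl
  · rw [show (2 : ℤ) + k - 0 - 1 = k + 1 by ring, show (2 : ℤ) + k - 1 = k + 1 by ring,
      show (2 : ℤ) + k - 2 = k by ring]
    change _ = vertexMode W.Y a k (vertexMode W.Y 𝒱.omega 2 u) + _ +
      vertexMode W.Y (vertexMode 𝒱.Y 𝒱.omega 2 a) k u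
    push_cast
    module

theorem mem_gr_iff (𝒱 : VertexOperatorAlgebra V) {n : ℤ} {a : V} :
    a ∈ 𝒱.gr n ↔ 𝒱.adjointModule.L 0 a = (n : ℂ) • a := by
  refine ⟨fun h => 𝒱.L_zero n a h, fun h => ?_⟩
  by_cases h0 : a = 0
  · simp [h0]
  · obtain ⟨k, hk, hx⟩ := 𝒱.exists_of_mem_eigenspace n a h h0
    rwa [Int.cast_inj.1 hk]

theorem mode_mem_gr (𝒱 : VertexOperatorAlgebra V) {m n : ℤ} {a b : V} (ha : a ∈ 𝒱.gr m)
    (hb : b ∈ 𝒱.gr n) (k : ℤ) : vertexMode 𝒱.Y a k b ∈ 𝒱.gr (m + n - k - 1) := by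
  rw [mem_gr_iff] at hb ⊢
  have h := 𝒱.adjointModule.L_zero_mode ha k b
  rw [hb, map_smul] at h
  refine h.trans ?_
  change (n : ℂ) • vertexMode 𝒱.Y a k b + ((m : ℂ) - k - 1) • vertexMode 𝒱.Y a k b = _
  push_cast
  module

theorem L_one_pow_mem_gr (𝒱 : VertexOperatorAlgebra V) {n : ℤ} {a : V} (ha : a ∈ 𝒱.gr n) (j : ℕ) :
    (𝒱.adjointModule.L 1 ^ j) a ∈ 𝒱.gr (n - j) := by
  induction j with
  | zero => simpa using ha
  | succ j ih =>
    have h := 𝒱.mode_mem_gr 𝒱.omega_mem ih (1 + 1)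
    rw [pow_succ', Module.End.mul_apply]
    rwa [show n - ((j + 1 : ℕ) : ℤ) = 2 + (n - j) - (1 + 1) - 1 by push_cast; ring]

theorem L_neg_one_mem_gr (𝒱 : VertexOperatorAlgebra V) {n : ℤ} {a : V} (ha : a ∈ 𝒱.gr n) :
    vertexMode 𝒱.Y 𝒱.omega 0 a ∈ 𝒱.gr (n + 1) := by
  have h := 𝒱.mode_mem_gr 𝒱.omega_mem ha 0
  rwa [show 2 + n - 0 - 1 = n + 1 by ring] at h

theorem gr_induction (𝒱 : VertexOperatorAlgebra V) {p : V → Prop} (zero : p 0)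
    (mem : ∀ (n : ℤ), ∀ a ∈ 𝒱.gr n, p a) (add : ∀ a b, p a → p b → p (a + b)) (a : V) : p a := by
  have ha : a ∈ ⨆ n, 𝒱.gr n := by rw [𝒱.iSup_gr]; trivial
  exact Submodule.iSup_induction _ (motive := p) ha mem zero add

/-! ### Conjugation by `e^{π i L(0)}` and bijectivity of `φ_M` -/

theorem OrdinaryModule.semisimpleExp_mode (W : 𝒱.OrdinaryModule M) {n : ℤ} {a : V}
    (ha : a ∈ 𝒱.gr n) (k : ℤ) (u : M) :
    semisimpleExp (Real.pi * Complex.I) (W.L 0) W.isInternal (vertexMode W.Y a k u)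
      = (-1 : ℂ) ^ (n - k - 1) • vertexMode W.Y a k
          (semisimpleExp (Real.pi * Complex.I) (W.L 0) W.isInternal u) := by
  have hu : u ∈ ⨆ t : ℂ, (W.L 0).eigenspace t := by
    rw [((DirectSum.isInternal_submodule_iff_iSupIndep_and_iSup_eq_top _).1 W.isInternal).2]
    trivial
  induction hu using Submodule.iSup_induction' with
  | zero => simp
  | mem t x hx =>
    have hx := Module.End.mem_eigenspace_iff.1 hx
    have h := W.L_zero_mode ha k x
    rw [hx, map_smul, ← add_smul] at h
    rw [semisimpleExp_apply _ _ _ t x hx, semisimpleExp_apply _ _ _ _ _ h, map_smul, smul_smul]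
    congr 1
    rw [← Complex.exp_pi_mul_I, ← Complex.exp_int_mul, ← Complex.exp_add]
    congr 1
    push_cast
    ring
  | add x y _ _ hx hy => rw [map_add, map_add, map_add, hx, hy, map_add, smul_add]

theorem OrdinaryModule.phi_bijective (W : 𝒱.OrdinaryModule M) : Function.Bijective W.phi :=
  Function.Bijective.comp (g := locallyNilpotentExp (W.L 1) W.L_one_locally_nilpotent)
    ⟨locallyNilpotentExp_injective _ _, locallyNilpotentExp_surjective _ _⟩
    (semisimpleExp_bijective _ _ _)

theorem adjointModule_semisimpleExp (𝒱 : VertexOperatorAlgebra V) {n : ℤ} {a : V}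
    (ha : a ∈ 𝒱.gr n) : semisimpleExp (Real.pi * Complex.I) (𝒱.adjointModule.L 0)
      𝒱.adjointModule.isInternal a = (-1 : ℂ) ^ n • a := by
  rw [semisimpleExp_apply _ _ _ _ _ (𝒱.mem_gr_iff.1 ha), mul_comm, Complex.exp_int_mul,
    Complex.exp_pi_mul_I]

end modes
end VertexOperatorAlgebra

noncomputable section

namespace VertexOperatorAlgebra

section conjugation

variable {V : Type*} [AddCommGroup V] [Module ℂ V] {𝒱 : VertexOperatorAlgebra V}
  {M : Type*} [AddCommGroup M] [Module ℂ M]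

/-! ### Conjugation of modes by `e^{L(1)}` -/

/-- The operator `(ad L(1))^m / m!` applied to the mode `a_k` of a vector `a` of weight `n`. -/
def WeakModule.adMode (W : 𝒱.WeakModule M) (n : ℤ) (a : V) (k : ℤ) (m : ℕ) : Module.End ℂ M :=
  ∑ x ∈ Finset.HasAntidiagonal.antidiagonal m,
    ((x.1.factorial : ℂ)⁻¹ * (Ring.choose (2 * n - x.1 - k - 2) x.2 : ℤ)) •
      vertexMode W.Y ((𝒱.adjointModule.L 1 ^ x.1) a) (k + x.2)

theorem WeakModule.adMode_apply (W : 𝒱.WeakModule M) (n : ℤ) (a : V) (k : ℤ) (m : ℕ) (u : M) :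
    W.adMode n a k m u = ∑ x ∈ Finset.HasAntidiagonal.antidiagonal m,
      ((x.1.factorial : ℂ)⁻¹ * (Ring.choose (2 * n - x.1 - k - 2) x.2 : ℤ)) •
        vertexMode W.Y ((𝒱.adjointModule.L 1 ^ x.1) a) (k + x.2) u := by
  simp [WeakModule.adMode, LinearMap.sum_apply]

/-- This is the recursion `[L(1), A_m] = (m+1) A_{m+1}` that justifies reading `adMode` as `(ad
L(1))^m / m!`. -/
theorem WeakModule.L_one_adMode (W : 𝒱.WeakModule M) {n : ℤ} {a : V} (ha : a ∈ 𝒱.gr n) (k : ℤ)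
    (m : ℕ) (u : M) : W.L 1 (W.adMode n a k m u)
      = W.adMode n a k m (W.L 1 u) + ((m : ℂ) + 1) • W.adMode n a k (m + 1) u := by
  let F : ℕ × ℕ → M := fun x => vertexMode W.Y ((𝒱.adjointModule.L 1 ^ x.1) a) (k + x.2) u
  let X : ℕ → ℤ := fun j => 2 * n - j - k - 2
  -- The factor `m + 1 = j + r` is split in two: `d₂` collects what arises from `(j-1, r)` by
  -- applying `L(1)` to the vector, `d₁` what arises from `(j, r-1)` by raising the mode.
  let d₁ : ℕ × ℕ → ℂ := fun x => (x.1.factorial : ℂ)⁻¹ * ((x.2 * Ring.choose (X x.1) x.2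
    - x.1 * (Ring.choose (X x.1 + 1) x.2 - Ring.choose (X x.1) x.2) : ℤ) : ℂ)
  let d₂ : ℕ × ℕ → ℂ := fun x => (x.1.factorial : ℂ)⁻¹ * x.1 * (Ring.choose (X x.1 + 1) x.2 : ℤ)
  have h₁ : ∑ x ∈ Finset.HasAntidiagonal.antidiagonal (m + 1), d₁ x • F x
      = ∑ x ∈ Finset.HasAntidiagonal.antidiagonal m, ((x.1.factorial : ℂ)⁻¹ *
          (Ring.choose (X x.1) x.2 : ℤ) * ((X x.1 - x.1 - x.2 : ℤ) : ℂ)) • F (x.1, x.2 + 1) := by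
    rw [Finset.Nat.sum_antidiagonal_succ']
    have h0 : d₁ (m + 1, 0) = 0 := by simp [d₁]
    rw [h0, zero_smul, zero_add]
    refine Finset.sum_congr rfl fun x _ => ?_
    congr 1
    simp only [d₁]
    rw [mul_assoc, ← Int.cast_mul]
    congr 2
    rw [Ring.choose_succ_succ]
    push_cast
    rw [Int.succ_mul_choose_succ]
    ring
  have h₂ : ∑ x ∈ Finset.HasAntidiagonal.antidiagonal (m + 1), d₂ x • F x
      = ∑ x ∈ Finset.HasAntidiagonal.antidiagonal m, ((x.1.factorial : ℂ)⁻¹ *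
          (Ring.choose (X x.1) x.2 : ℤ)) • F (x.1 + 1, x.2) := by
    rw [Finset.Nat.sum_antidiagonal_succ]
    have h0 : d₂ (0, m + 1) = 0 := by simp [d₂]
    rw [h0, zero_smul, zero_add]
    refine Finset.sum_congr rfl fun x _ => ?_
    congr 1
    simp only [d₂]
    have hf : ((x.1 + 1).factorial : ℂ)⁻¹ * ((x.1 + 1 : ℕ) : ℂ) = (x.1.factorial : ℂ)⁻¹ := by
      have := Nat.cast_ne_zero (R := ℂ).2 (Nat.succ_ne_zero x.1)
      rw [Nat.factorial_succ]
      push_cast at this ⊢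
      field_simp
    rw [hf]
    congr 3
    simp only [X]
    push_cast
    ring
  have h₃ : ((m : ℂ) + 1) • W.adMode n a k (m + 1) u
      = ∑ x ∈ Finset.HasAntidiagonal.antidiagonal (m + 1), d₁ x • F x
        + ∑ x ∈ Finset.HasAntidiagonal.antidiagonal (m + 1), d₂ x • F x := by
    rw [W.adMode_apply, Finset.smul_sum, ← Finset.sum_add_distrib]
    refine Finset.sum_congr rfl fun x hx => ?_
    have hx : (x.1 : ℂ) + x.2 = m + 1 := by
      exact_mod_cast Finset.HasAntidiagonal.mem_antidiagonal.1 hx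
    rw [← hx, ← add_smul, smul_smul]
    congr 1
    simp only [d₁, d₂, X]
    push_cast
    ring
  rw [h₃, h₁, h₂, W.adMode_apply, map_sum, W.adMode_apply, ← Finset.sum_add_distrib,
    ← Finset.sum_add_distrib]
  refine Finset.sum_congr rfl fun x _ => ?_
  rw [map_smul, W.L_one_mode (𝒱.L_one_pow_mem_gr ha x.1)]
  simp only [F, X, pow_succ', Module.End.mul_apply]
  rw [show k + ((x.2 + 1 : ℕ) : ℤ) = k + x.2 + 1 by push_cast; ring,
    show 2 * (n - (x.1 : ℤ)) - (k + x.2) - 2 = 2 * n - x.1 - k - 2 - x.1 - x.2 by ring]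
  module

/-- The Leibniz rule with divided powers. The induction multiplies by `N + 1` and splits it as `x.1
+ x.2` on the diagonal. -/
theorem WeakModule.L_one_pow_mode (W : 𝒱.WeakModule M) {n : ℤ} {a : V} (ha : a ∈ 𝒱.gr n) (k : ℤ)
    (N : ℕ) (u : M) : (N.factorial : ℂ)⁻¹ • (W.L 1 ^ N) (vertexMode W.Y a k u)
      = ∑ x ∈ Finset.HasAntidiagonal.antidiagonal N,
          W.adMode n a k x.1 ((x.2.factorial : ℂ)⁻¹ • (W.L 1 ^ x.2) u) := by
  have hf : ∀ s : ℕ, ((s + 1).factorial : ℂ)⁻¹ * ((s : ℂ) + 1) = (s.factorial : ℂ)⁻¹ := by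
    intro s
    have := Nat.cast_ne_zero (R := ℂ).2 (Nat.succ_ne_zero s)
    rw [Nat.factorial_succ]
    push_cast at this ⊢
    field_simp
  induction N with
  | zero => simp [W.adMode_apply]
  | succ N ih =>
    have hN : ((N : ℂ) + 1) ≠ 0 := by exact_mod_cast Nat.succ_ne_zero N
    refine smul_right_injective M hN ?_
    simp only
    have hs : ∀ s : ℕ, W.L 1 ((s.factorial : ℂ)⁻¹ • (W.L 1 ^ s) u)
        = ((s : ℂ) + 1) • ((s + 1).factorial : ℂ)⁻¹ • (W.L 1 ^ (s + 1)) u := by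
      intro s
      rw [smul_smul, mul_comm, hf, map_smul, pow_succ', Module.End.mul_apply]
    rw [smul_smul, mul_comm, hf, pow_succ', Module.End.mul_apply, ← map_smul, ih, map_sum,
      Finset.smul_sum]
    simp only [W.L_one_adMode ha, hs, Finset.sum_add_distrib]
    have h₁ := Finset.Nat.sum_antidiagonal_succ' (n := N) (f := fun x : ℕ × ℕ =>
      (x.2 : ℂ) • W.adMode n a k x.1 ((x.2.factorial : ℂ)⁻¹ • (W.L 1 ^ x.2) u))
    have h₂ := Finset.Nat.sum_antidiagonal_succ (n := N) (f := fun x : ℕ × ℕ =>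
      (x.1 : ℂ) • W.adMode n a k x.1 ((x.2.factorial : ℂ)⁻¹ • (W.L 1 ^ x.2) u))
    simp only [Nat.cast_zero, zero_smul, zero_add, Nat.cast_add, Nat.cast_one] at h₁ h₂
    simp only [map_smul] at h₁ h₂ ⊢
    rw [← h₁, ← h₂, ← Finset.sum_add_distrib]
    refine Finset.sum_congr rfl fun x hx => ?_
    have hx : (x.1 : ℂ) + x.2 = N + 1 := by
      exact_mod_cast Finset.HasAntidiagonal.mem_antidiagonal.1 hx
    rw [← hx]
    module

theorem WeakModule.exists_adMode_eq_zero (W : 𝒱.WeakModule M) (n : ℤ) (a : V) (k : ℤ) (u : M) :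
    ∃ N : ℕ, ∀ m, N ≤ m → W.adMode n a k m u = 0 := by
  obtain ⟨J, hJ⟩ := 𝒱.adjointModule.L_one_locally_nilpotent a
  have hJ' : ∀ j, J ≤ j → (𝒱.adjointModule.L 1 ^ j) a = 0 := fun j hj =>
    Module.End.pow_apply_eq_zero_of_le hJ hj
  obtain ⟨K, hK⟩ := exists_forall_vertexMode_eq_zero W.Y _ J hJ' u
  refine ⟨J + K + k.natAbs, fun m hm => ?_⟩
  rw [W.adMode_apply]
  refine Finset.sum_eq_zero fun x hx => ?_
  have hx := Finset.HasAntidiagonal.mem_antidiagonal.1 hx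
  by_cases h : J ≤ x.1
  · rw [hJ' _ h, vertexMode_zero, LinearMap.zero_apply, smul_zero]
  · rw [hK _ _ (by lia), smul_zero]

/-- The coefficients of
`e^{L(1)} Y_M(a, z) e^{-L(1)} = Y_M(e^{(1-z)L(1)} (1-z)^{-2L(0)} a, z/(1-z))`. -/
theorem OrdinaryModule.exp_L_one_mode (W : 𝒱.OrdinaryModule M) {n : ℤ} {a : V} (ha : a ∈ 𝒱.gr n)
    (k : ℤ) (u : M) :
    locallyNilpotentExp (W.L 1) W.L_one_locally_nilpotent (vertexMode W.Y a k u)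
      = ∑ᶠ j : ℕ, ∑ᶠ r : ℕ,
          ((j.factorial : ℂ)⁻¹ * (Ring.choose (2 * n - j - k - 2) r : ℤ)) •
            vertexMode W.Y ((𝒱.adjointModule.L 1 ^ j) a) (k + r)
              (locallyNilpotentExp (W.L 1) W.L_one_locally_nilpotent u) := by
  set v := locallyNilpotentExp (W.L 1) W.L_one_locally_nilpotent u with hv
  obtain ⟨S, hS⟩ := W.L_one_locally_nilpotent u
  have hS' : ∀ s, S ≤ s → (s.factorial : ℂ)⁻¹ • (W.L 1 ^ s) u = 0 := fun s hs => by
    rw [Module.End.pow_apply_eq_zero_of_le hS hs, smul_zero]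
  obtain ⟨J, hJ⟩ := 𝒱.adjointModule.L_one_locally_nilpotent a
  have hJ' : ∀ j, J ≤ j → (𝒱.adjointModule.L 1 ^ j) a = 0 := fun j hj =>
    Module.End.pow_apply_eq_zero_of_le hJ hj
  obtain ⟨K, hK⟩ := exists_forall_vertexMode_eq_zero W.Y _ J hJ' v
  choose N hN using fun s : ℕ =>
    W.exists_adMode_eq_zero n a k ((s.factorial : ℂ)⁻¹ • (W.L 1 ^ s) u)
  -- Only the finitely many `s < S` contribute, so the bounds `N s` have a common maximum.
  have hN' : ∀ m s, S + (Finset.range S).sup N ≤ m →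
      W.adMode n a k m ((s.factorial : ℂ)⁻¹ • (W.L 1 ^ s) u) = 0 := by
    intro m s hm
    by_cases hs : S ≤ s
    · rw [hS' s hs, map_zero]
    · have := Finset.le_sup (f := N) (Finset.mem_range.2 (not_le.1 hs))
      exact hN s m (by lia)
  have hN'' : ∀ m s, S + (Finset.range S).sup N ≤ s →
      W.adMode n a k m ((s.factorial : ℂ)⁻¹ • (W.L 1 ^ s) u) = 0 := by
    intro m s hs
    rw [hS' s (by lia), map_zero]
  -- The Leibniz double sum factors: summing over `s` first rebuilds `e^{L(1)} u`.
  have e₁ : locallyNilpotentExp (W.L 1) W.L_one_locally_nilpotent (vertexMode W.Y a k u)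
      = ∑ᶠ m, W.adMode n a k m v := by
    rw [locallyNilpotentExp_apply]
    simp only [W.L_one_pow_mode ha]
    rw [finsum_sum_antidiagonal (f := fun m s => W.adMode n a k m
      ((s.factorial : ℂ)⁻¹ • (W.L 1 ^ s) u)) _ hN' hN'']
    refine finsum_congr fun m => ?_
    rw [hv, locallyNilpotentExp_apply, map_finsum _ (finite_support_of_eventually_zero S hS')]
  rw [e₁]
  simp only [W.adMode_apply]
  refine finsum_sum_antidiagonal (f := fun j r =>
    ((j.factorial : ℂ)⁻¹ * (Ring.choose (2 * n - j - k - 2) r : ℤ)) •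
      vertexMode W.Y ((𝒱.adjointModule.L 1 ^ j) a) (k + r) v) (J + K + k.natAbs) ?_ ?_
  · intro j r hj
    rw [hJ' j (by lia), vertexMode_zero, LinearMap.zero_apply, smul_zero]
  · intro j r hr
    rw [hK _ _ (by lia), smul_zero]

/-! ### Residues under `φ_M` -/

theorem OrdinaryModule.phi_apply (W : 𝒱.OrdinaryModule M) (u : M) :
    W.phi u = locallyNilpotentExp (W.L 1) W.L_one_locally_nilpotent
      (semisimpleExp (Real.pi * Complex.I) (W.L 0) W.isInternal u) := rfl

theorem OrdinaryModule.phi_zhuRes (W : 𝒱.OrdinaryModule M) (s q : ℤ) (a : V) (u : M) :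
    W.phi (W.zhuRes s q a u)
      = (-1 : ℂ) ^ (q + 1) • W.zhuRes (q - 2 - s) q (𝒱.adjointModule.phi a) (W.phi u) := by
  induction a using 𝒱.gr_induction with
  | zero => simp
  | add a b ha hb => simp only [map_add, LinearMap.add_apply, ha, hb, smul_add]
  | mem n a ha =>
    set v := W.phi u with hv
    obtain ⟨J, hJ⟩ := 𝒱.adjointModule.L_one_locally_nilpotent a
    have hJ' : ∀ j, J ≤ j → (𝒱.adjointModule.L 1 ^ j) a = 0 := fun j hj =>
      Module.End.pow_apply_eq_zero_of_le hJ hj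
    obtain ⟨K, hK⟩ := exists_forall_vertexMode_eq_zero W.Y _ J hJ' v
    obtain ⟨K', hK'⟩ := exists_vertexMode_eq_zero W.Y a u
    -- Here `i` comes from expanding `(1+z)^{n+s}`, while `j` and `r` come from conjugating the mode
    -- `a_{i-q}` by `e^{L(1)}`.
    let F : ℕ → ℕ → ℕ → M := fun i j r =>
      ((j.factorial : ℂ)⁻¹ * (((-1) ^ i * Ring.choose (n + s) i *
        Ring.choose (2 * n - j + q - 2 - i) r : ℤ) : ℂ)) •
        vertexMode W.Y ((𝒱.adjointModule.L 1 ^ j) a) (i + r - q) v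
    have hF₁ : ∀ i j r, J + K + q.natAbs ≤ i → F i j r = 0 := fun i j r h => by
      simp only [F]
      rw [hK _ _ (by lia), smul_zero]
    have hF₂ : ∀ i j r, J + K + q.natAbs ≤ j → F i j r = 0 := fun i j r h => by
      simp only [F]
      rw [hJ' j (by lia), vertexMode_zero, LinearMap.zero_apply, smul_zero]
    have hF₃ : ∀ i j r, J + K + q.natAbs ≤ r → F i j r = 0 := fun i j r h => by
      simp only [F]
      rw [hK _ _ (by lia), smul_zero]
    have hl : W.phi (W.zhuRes s q a u)
        = (-1 : ℂ) ^ (n + q + 1) • ∑ᶠ i, ∑ᶠ j, ∑ᶠ r, F i j r := by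
      rw [W.zhuRes_apply s q n a ha, map_finsum _ (finite_support_of_eventually_zero
        (K' + q.natAbs) fun i hi => by rw [hK' _ (by lia), smul_zero]), smul_finsum]
      refine finsum_congr fun i => ?_
      rw [map_smul, W.phi_apply, W.semisimpleExp_mode ha, map_smul, W.exp_L_one_mode ha,
        ← W.phi_apply, ← hv, smul_finsum, smul_finsum, smul_finsum]
      refine finsum_congr fun j => ?_
      rw [smul_finsum, smul_finsum, smul_finsum]
      refine finsum_congr fun r => ?_
      simp only [F, smul_smul]
      rw [show (i : ℤ) - q + r = i + r - q by ring,
        show 2 * n - j - (i - q) - 2 = 2 * n - j + q - 2 - i by ring,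
        -- Written so that the sign splits into the global factor `(-1)^{n+q+1}` and the `(-1)^i`
        -- required by the binomial identity.
        show n - (i - q) - 1 = n + q + 1 - 2 - i by ring,
        zpow_sub₀ (by norm_num), zpow_sub₀ (by norm_num)]
      congr 1
      have hi : ((-1 : ℂ) ^ (i : ℤ))⁻¹ = (-1) ^ i := by
        rw [zpow_natCast, ← inv_pow]; norm_num
      rw [div_eq_mul_inv _ ((-1 : ℂ) ^ (i : ℤ)), hi]
      push_cast
      norm_num
      ring
    have hr : 𝒱.adjointModule.phi a
        = (-1 : ℂ) ^ n • ∑ᶠ j : ℕ, (j.factorial : ℂ)⁻¹ • (𝒱.adjointModule.L 1 ^ j) a := by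
      rw [𝒱.adjointModule.phi_apply, 𝒱.adjointModule_semisimpleExp ha, map_smul]
      rfl
    have hr' : W.zhuRes (q - 2 - s) q (𝒱.adjointModule.phi a) v
        = (-1 : ℂ) ^ n • ∑ᶠ j : ℕ, (j.factorial : ℂ)⁻¹ •
            W.zhuRes (q - 2 - s) q ((𝒱.adjointModule.L 1 ^ j) a) v := by
      rw [hr, map_smul, LinearMap.smul_apply, ← LinearMap.flip_apply,
        map_finsum _ (finite_support_of_eventually_zero J fun j hj => by rw [hJ' j hj, smul_zero])]
      simp
    rw [hl, hr', smul_smul, ← zpow_add₀ (by norm_num), show q + 1 + n = n + q + 1 by ring]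
    congr 1
    rw [finsum_comm_of_eventually_zero (f := fun i j => ∑ᶠ r, F i j r) (J + K + q.natAbs)
      (fun i j h => by simp [hF₁ i j _ h]) (fun i j h => by simp [hF₂ i j _ h])]
    refine finsum_congr fun j => ?_
    rw [← finsum_sum_antidiagonal (f := fun i r => F i j r) (J + K + q.natAbs)
      (fun i r h => hF₁ i j r h) (fun i r h => hF₃ i j r h),
      W.zhuRes_apply _ q _ _ (𝒱.L_one_pow_mem_gr ha j), smul_finsum]
    refine finsum_congr fun k => ?_
    -- All terms with `i + r = k` involve the same mode `k - q`, and their coefficients sum to the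
    -- binomial coefficient for `L(1)^j a`, of weight `n - j`.
    rw [show n - (j : ℤ) + (q - 2 - s) = 2 * n - j + q - 2 - (n + s) by ring,
      ← Int.sum_antidiagonal_neg_one_pow_mul_choose_mul_choose, Int.cast_sum, Finset.sum_smul,
      Finset.smul_sum]
    refine Finset.sum_congr rfl fun x hx => ?_
    have hx : (x.1 : ℤ) + x.2 = k := by
      exact_mod_cast Finset.HasAntidiagonal.mem_antidiagonal.1 hx
    simp only [F]
    rw [hx, smul_smul]

end conjugation

end VertexOperatorAlgebra

end

namespace VertexOperatorAlgebra

section zhu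

variable {V : Type*} [AddCommGroup V] [Module ℂ V] {𝒱 : VertexOperatorAlgebra V}
  {M : Type*} [AddCommGroup M] [Module ℂ M]

/-! ### The two actions of `A(V)` on itself coincide -/

/-- The element is `a ∘ 𝟏`: only `a_{-2} 𝟏 = L(-1)a` and `a_{-1} 𝟏 = a` survive. -/
theorem L_neg_one_add_smul_mem_zhuO (𝒱 : VertexOperatorAlgebra V) {n : ℤ} {a : V}
    (ha : a ∈ 𝒱.gr n) :
    vertexMode 𝒱.Y 𝒱.omega 0 a + (n : ℂ) • a ∈ 𝒱.adjointModule.zhuO := by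
  refine Submodule.subset_span ⟨a, 𝒱.vac, ?_⟩
  rw [WeakModule.circ, WeakModule.zhuRes_apply _ 0 2 n a ha, finsum_eq_sum_range 2]
  · change _ = ∑ i ∈ Finset.range 2, ((Ring.choose (n + 0) i : ℤ) : ℂ) •
      vertexMode 𝒱.Y a (i - 2) 𝒱.vac
    have h := 𝒱.Y_neg_one_vac a
    simp [Finset.sum_range_succ, 𝒱.L_neg_one_eq, h]
  · intro i hi
    change _ • vertexMode 𝒱.Y a (i - 2) 𝒱.vac = 0
    rw [𝒱.Y_apply_vac a _ (by lia), smul_zero]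

/-- `e^{z L(-1)} a ≡ (1+z)^{-wt a} a` modulo `O(V)`. -/
theorem mkQ_mode_vac (𝒱 : VertexOperatorAlgebra V) (i : ℕ) :
    ∀ {n : ℤ} {a : V}, a ∈ 𝒱.gr n →
      𝒱.adjointModule.zhuO.mkQ (vertexMode 𝒱.Y a (-1 - i) 𝒱.vac)
        = ((Ring.choose (-n) i : ℤ) : ℂ) • 𝒱.adjointModule.zhuO.mkQ a := by
  induction i with
  | zero =>
    intro n a _
    have h := 𝒱.Y_neg_one_vac a
    simp [h]
  | succ i ih =>
    intro n a ha
    have h₁ := ih (𝒱.L_neg_one_mem_gr ha)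
    have h₂ : 𝒱.adjointModule.zhuO.mkQ (vertexMode 𝒱.Y 𝒱.omega 0 a)
        = -(n : ℂ) • 𝒱.adjointModule.zhuO.mkQ a := by
      have h := (Submodule.Quotient.mk_eq_zero _).2 (𝒱.L_neg_one_add_smul_mem_zhuO ha)
      rw [← Submodule.mkQ_apply, map_add, map_smul, add_eq_zero_iff_eq_neg] at h
      rw [h, neg_smul]
    -- The derivative property gives `(i+1) a_{-2-i} 𝟏 = (L(-1)a)_{-1-i} 𝟏`, so the induction
    -- hypothesis is applied to `L(-1)a`, of weight `n + 1`.
    have hi : ((i : ℂ) + 1) ≠ 0 := by exact_mod_cast Nat.succ_ne_zero i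
    refine smul_right_injective _ hi ?_
    simp only
    rw [h₂, 𝒱.L_neg_one, LinearMap.smul_apply, map_smul, smul_smul] at h₁
    have hc := congrArg (Int.cast (R := ℂ)) (Int.succ_mul_choose_succ' (-n) i)
    push_cast at hc h₁
    rw [smul_smul, hc, show (-1 - ((i + 1 : ℕ) : ℤ)) = -1 - i - 1 by push_cast; ring]
    convert h₁ using 2
    · ring
    · rw [show -(n + 1) = -n - 1 by ring]
      ring

/-- Skew-symmetry `Y(a, z) b = e^{z L(-1)} Y(b, -z) a`, with `e^{z L(-1)} c = Y(c, z) 1`. -/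
theorem skew_symmetry (𝒱 : VertexOperatorAlgebra V) (a b : V) (l : ℤ) :
    vertexMode 𝒱.Y a l b = ∑ᶠ j : ℕ, (-1 : ℂ) ^ (l + 1 + j) •
      vertexMode 𝒱.Y (vertexMode 𝒱.Y b (l + j) a) (-1 - j) 𝒱.vac := by
  -- On the vacuum these indices leave a single term on the left, `-(-1)^l a_l b_{-1} 𝟏 = -(-1)^l
  -- a_l b`.
  have h := 𝒱.jacobi b a 𝒱.vac l (-1) 0
  have hc : ∀ j : ℕ, Ring.choose (-1 : ℤ) j = (-1) ^ j := by
    intro j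
    have h1 := Int.choose_neg_eq 1 j
    rw [show (1 : ℤ) + j - 1 = (j : ℕ) by ring, Ring.choose_natCast, Nat.choose_self] at h1
    simpa using h1
  have hb := 𝒱.Y_neg_one_vac b
  rw [finsum_eq_single _ 0] at h
  · rw [𝒱.Y_apply_vac a _ (by simp)] at h
    simp only [pow_zero, Ring.choose_zero_right, Int.cast_one, one_mul, map_zero, zero_sub,
      Nat.cast_zero, add_zero, sub_zero, one_smul, hb, hc] at h
    have hs : (-1 : ℂ) ^ (l + 1) * -(-1) ^ l = 1 := by
      rw [zpow_add₀ (by norm_num), zpow_one, mul_neg, mul_neg_one, neg_mul, neg_neg,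
        ← mul_zpow]
      norm_num
    have h' := congrArg (fun x => (-1 : ℂ) ^ (l + 1) • x) h
    simp only [smul_finsum, smul_smul] at h'
    rw [← neg_smul, smul_smul, hs, one_smul] at h'
    rw [h']
    refine finsum_congr fun j => ?_
    rw [zpow_add₀ (by norm_num) (l + 1), zpow_natCast]
    push_cast
    rfl
  · intro i hi
    rw [𝒱.Y_apply_vac a _ (by simp), 𝒱.Y_apply_vac b _ (by lia)]
    simp

/-- Modulo `O(V)`, skew-symmetry reads `Y(a,z)b ≡ (1+z)^{-wt a - wt b} Y(b, -z/(1+z)) a`;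
substituting `w = -z/(1+z)` in the residue turns one product into the other. -/
theorem mkQ_rmul_eq_mkQ_lmul (𝒱 : VertexOperatorAlgebra V) (a b : V) :
    𝒱.adjointModule.zhuO.mkQ (𝒱.adjointModule.rmul b a)
      = 𝒱.adjointModule.zhuO.mkQ (𝒱.adjointModule.lmul b a) := by
  set π := 𝒱.adjointModule.zhuO.mkQ
  rw [WeakModule.rmul, WeakModule.lmul]
  induction a using 𝒱.gr_induction with
  | zero => simp
  | add a a' ha ha' => simp only [map_add, LinearMap.add_apply, ha, ha']
  | mem m a ha =>
  induction b using 𝒱.gr_induction with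
  | zero => simp
  | add b b' hb hb' => simp only [map_add, LinearMap.add_apply, hb, hb']
  | mem n b hb =>
    rw [WeakModule.zhuRes_apply _ _ _ _ _ ha, WeakModule.zhuRes_apply _ _ _ _ _ hb]
    change π (∑ᶠ i : ℕ, ((Ring.choose (m + -1) i : ℤ) : ℂ) • vertexMode 𝒱.Y a (i - 1) b)
      = π (∑ᶠ i : ℕ, ((Ring.choose (n + 0) i : ℤ) : ℂ) • vertexMode 𝒱.Y b (i - 1) a)
    obtain ⟨K, hK⟩ := exists_vertexMode_eq_zero 𝒱.Y a b
    obtain ⟨K', hK'⟩ := exists_vertexMode_eq_zero 𝒱.Y b a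
    have hskew : ∀ i : ℕ, π (vertexMode 𝒱.Y a (i - 1) b) = ∑ᶠ j : ℕ,
        ((-1 : ℂ) ^ (i + j) * (Ring.choose (((i + j : ℕ) : ℤ) - n - m) j : ℤ)) •
          π (vertexMode 𝒱.Y b (((i + j : ℕ) : ℤ) - 1) a) := by
      intro i
      rw [𝒱.skew_symmetry, map_finsum _ (finite_support_of_eventually_zero (K' + 1) fun j hj => by
        rw [hK' _ (by lia), vertexMode_zero, LinearMap.zero_apply, smul_zero])]
      refine finsum_congr fun j => ?_
      rw [map_smul, 𝒱.mkQ_mode_vac j (𝒱.mode_mem_gr hb ha _), smul_smul,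
        show ((i : ℤ) - 1 + 1 + j) = ((i + j : ℕ) : ℤ) by push_cast; ring, zpow_natCast,
        show (i : ℤ) - 1 + j = ((i + j : ℕ) : ℤ) - 1 by push_cast; ring]
      congr 4
      ring
    rw [map_finsum _ (finite_support_of_eventually_zero (K + 1) fun i hi => by
        rw [hK _ (by lia), smul_zero]),
      map_finsum _ (finite_support_of_eventually_zero (K' + 1) fun i hi => by
        rw [hK' _ (by lia), smul_zero])]
    simp only [map_smul, hskew, smul_finsum, smul_smul]
    rw [← finsum_sum_antidiagonal (K' + 1)]
    · refine finsum_congr fun k => ?_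
      -- For `i + j = k` every term contains `b_{k-1} a`, of weight `n + m - k`. Vandermonde gives
      -- the coefficient `(k-n-1 choose k)`, which is `(-1)^k (n choose k)`.
      have hc := Ring.add_choose_eq k (Commute.all (m + -1) ((k : ℤ) - n - m))
      have hc' := Int.choose_neg_eq (n + 1 - k) k
      rw [show -(n + 1 - (k : ℤ)) = m + -1 + (k - n - m) by ring,
        show n + 1 - (k : ℤ) + k - 1 = n + 0 by ring, hc] at hc'
      have hs : ((-1 : ℤ) ^ k) * (-1) ^ k = 1 := by rw [← mul_pow]; simp
      have hn : Ring.choose (n + 0) k = (-1) ^ k * ∑ x ∈ Finset.HasAntidiagonal.antidiagonal k,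
          Ring.choose (m + -1) x.1 * Ring.choose ((k : ℤ) - n - m) x.2 := by
        rw [hc', ← mul_assoc, hs, one_mul]
      rw [hn, Finset.mul_sum, Int.cast_sum, Finset.sum_smul]
      refine Finset.sum_congr rfl fun x hx => ?_
      rw [Finset.HasAntidiagonal.mem_antidiagonal.1 hx]
      congr 1
      push_cast
      ring
    · intro i j hi
      rw [hK' _ (by push_cast; lia), map_zero, smul_zero]
    · intro i j hj
      rw [hK' _ (by push_cast; lia), map_zero, smul_zero]

/-! ### The three identities and the induced maps on `A(M)` and `A(V)` -/

theorem OrdinaryModule.phi_lmul (W : 𝒱.OrdinaryModule M) (a : V) (u : M) :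
    W.phi (W.lmul a u) = W.rmul (W.phi u) (𝒱.adjointModule.phi a) := by
  have h := W.phi_zhuRes 0 1 a u
  norm_num at h
  exact h

theorem OrdinaryModule.phi_rmul (W : 𝒱.OrdinaryModule M) (a : V) (u : M) :
    W.phi (W.rmul u a) = W.lmul (𝒱.adjointModule.phi a) (W.phi u) := by
  have h := W.phi_zhuRes (-1) 1 a u
  norm_num at h
  exact h

theorem OrdinaryModule.phi_circ (W : 𝒱.OrdinaryModule M) (a : V) (u : M) :
    W.phi (W.circ a u) = -W.circ (𝒱.adjointModule.phi a) (W.phi u) := by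
  have h := W.phi_zhuRes 0 2 a u
  have h3 : (-1 : ℂ) ^ (2 + 1 : ℤ) = -1 := by rw [zpow_add₀ (by norm_num)]; norm_num
  rw [h3, neg_one_smul] at h
  norm_num at h
  exact h

theorem OrdinaryModule.map_phi_zhuO (W : 𝒱.OrdinaryModule M) :
    W.zhuO.map W.phi = W.zhuO := by
  rw [WeakModule.zhuO, Submodule.map_span]
  refine le_antisymm (Submodule.span_le.2 ?_) (Submodule.span_le.2 ?_)
  · rintro _ ⟨_, ⟨a, u, rfl⟩, rfl⟩
    rw [W.phi_circ]
    exact Submodule.neg_mem _ (Submodule.subset_span ⟨_, _, rfl⟩)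
  · rintro _ ⟨a, u, rfl⟩
    -- Surjectivity of both `φ_V` and `φ_M` makes every generator of `O(M)` an image of an element
    -- of `O(M)`; injectivity on the quotient depends on this inclusion.
    obtain ⟨a, rfl⟩ := 𝒱.adjointModule.phi_bijective.2 a
    obtain ⟨u, rfl⟩ := W.phi_bijective.2 u
    rw [← neg_neg (W.circ _ _), ← W.phi_circ]
    exact Submodule.neg_mem _ (Submodule.subset_span ⟨_, ⟨a, u, rfl⟩, rfl⟩)

theorem OrdinaryModule.exists_zhuA_equiv (W : 𝒱.OrdinaryModule M) :
    ∃ Φ : W.zhuA ≃ₗ[ℂ] W.zhuA, ∀ u : M, Φ (W.zhuO.mkQ u) = W.zhuO.mkQ (W.phi u) :=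
  ⟨Submodule.Quotient.equiv _ _ (LinearEquiv.ofBijective W.phi W.phi_bijective) W.map_phi_zhuO,
    fun _ => rfl⟩

end zhu

end VertexOperatorAlgebra

theorem proposition3p5 {V : Type*} [AddCommGroup V] [Module ℂ V] (𝒱 : VertexOperatorAlgebra V)
    {M : Type*} [AddCommGroup M] [Module ℂ M] (W : 𝒱.OrdinaryModule M) :
    -- the three identities on `M`
    (∀ (a : V) (u : M), W.phi (W.lmul a u) = W.rmul (W.phi u) (𝒱.adjointModule.phi a)) ∧
    (∀ (a : V) (u : M), W.phi (W.rmul u a) = W.lmul (𝒱.adjointModule.phi a) (W.phi u)) ∧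
    (∀ (a : V) (u : M), W.phi (W.circ a u) = - W.circ (𝒱.adjointModule.phi a) (W.phi u)) ∧
    -- the induced linear automorphism of `A(M)` that exchanges the left and right actions
    (∃ Φ : W.zhuA ≃ₗ[ℂ] W.zhuA,
      (∀ u : M, Φ (W.zhuO.mkQ u) = W.zhuO.mkQ (W.phi u)) ∧
      (∀ (a : V) (u : M), Φ (W.zhuO.mkQ (W.lmul a u))
        = W.zhuO.mkQ (W.rmul (W.phi u) (𝒱.adjointModule.phi a))) ∧
      (∀ (a : V) (u : M), Φ (W.zhuO.mkQ (W.rmul u a))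
        = W.zhuO.mkQ (W.lmul (𝒱.adjointModule.phi a) (W.phi u)))) ∧
    -- for `M = V`: the induced anti-automorphism of `A(V)`
    (∃ Ψ : 𝒱.adjointModule.zhuA ≃ₗ[ℂ] 𝒱.adjointModule.zhuA,
      (∀ a : V, Ψ (𝒱.adjointModule.zhuO.mkQ a)
        = 𝒱.adjointModule.zhuO.mkQ (𝒱.adjointModule.phi a)) ∧
      (∀ a b : V, Ψ (𝒱.adjointModule.zhuO.mkQ (𝒱.adjointModule.lmul a b))
        = 𝒱.adjointModule.zhuO.mkQ
            (𝒱.adjointModule.lmul (𝒱.adjointModule.phi b) (𝒱.adjointModule.phi a)))) := by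
  obtain ⟨Φ, hΦ⟩ := W.exists_zhuA_equiv
  obtain ⟨Ψ, hΨ⟩ := 𝒱.adjointModule.exists_zhuA_equiv
  refine ⟨W.phi_lmul, W.phi_rmul, W.phi_circ, ⟨Φ, hΦ, fun a u => ?_, fun a u => ?_⟩,
    ⟨Ψ, hΨ, fun a b => ?_⟩⟩
  · rw [hΦ, W.phi_lmul]
  · rw [hΦ, W.phi_rmul]
  · rw [hΨ, 𝒱.adjointModule.phi_lmul, 𝒱.mkQ_rmul_eq_mkQ_lmul]
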